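/- Let $X$ be a real Banach space with topological dual $X^*$ and bidual $X^{**}$, regard $X$ as a subspace of $X^{**}$ through the canonical injection, and write $\langle x,x^*\rangle=x^*(x)$, $\langle x^*,x^{**}\rangle=x^{**}(x^*)$, $\pi(x,x^*)=\langle x,x^*\rangle$ on $X\times X^*$ and $\pi_*(x^*,x^{**})=\langle x^*,x^{**}\rangle$ on $X^*\times X^{**}$. Let $T\colon X\rightrightarrows X^*$ be a point-to-set operator, identified with its graph $T\subset X\times X^*$. It is monotone if $\langle x-y,x^*-y^*\rangle\ge 0$ for all $(x,x^*),(y,y^*)\in T$, and maximal monotone if it is maximal, with respect to inclusion, among the monotone subsets of $X\times X^*$. Let $\mathcal F_T$ be the set of all convex and (norm) lower semicontinuous functions $h\colon X\times X^*\to[-\infty,\infty]$ such that $h\ge\pi$ on $X\times X^*$ and $h=\pi$ on $T$. For $h\colon X\times X^*\to[-\infty,\infty]$ let $h^*\colon X^*\times X^{**}\to[-\infty,\infty]$ be its conjugate, $$h^*(x^*,x^{**})=\sup_{(y,y^*)\in X\times X^*}\langle y,x^*\rangle+\langle y^*,x^{**}\rangle-h(y,y^*),$$ and, for $(x_0,x_0^*)\in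 X\times X^*$, let $$h_{(x_0,x_0^*)}(x,x^*)=h(x+x_0,x^*+x_0^*)-\bigl[\langle x,x_0^*\rangle+\langle x_0,x^*\rangle+\langle x_0,x_0^*\rangle\bigr].$$ Say that $h$ satisfies the auxiliary condition if $$\inf_{(x,x^*)\in X\times X^*}\Bigl(h_{(x_0,x_0^*)}(x,x^*)+\tfrac12\|x\|^2+\tfrac12\|x^*\|^2\Bigr)=0\qquad\text{for all }(x_0,x_0^*)\in X\times X^*.$$ Then the following conditions are equivalent. 1. $T$ is of type MA, that is, $T$ is maximal monotone and there exists some $h\in\mathcal F_T$ such that $h^*\ge\pi_*$ (and $h\ge\pi$). 2. $T$ is maximal monotone and all $h\in\mathcal F_T$ satisfy $h^*\ge\pi_*$ (and $h\ge\pi$). 3. $T$ is maximal monotone and some $h\in\mathcal F_T$ satisfies the auxiliary condition. 4. $T$ is maximal monotone and all $h\in\mathcal F_T$ satisfy the auxiliary condition. 5. $T$ is of type NI, that is, $T$ is maximal monotone and $$\inf_{(y,y^*)\in T}\langle x^{*}-y^{*},x^{**}-y\rangle\le 0\qquad\text{for all }(x^*,x^{**})\in X^*\times X^{**}.$$ In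 particular, type MA coincides with type NI. -/

import Mathlib

noncomputable section

namespace Fitzpatrick

variable {X : Type*} [NormedAddCommGroup X] [NormedSpace ℝ X]

/-- The duality product `π` on `X × X*`. -/
def pairing (p : X × StrongDual ℝ X) : ℝ := p.2 p.1

/-- The duality product `π_*` on `X* × X**`. -/
def pairingStar (q : StrongDual ℝ X × StrongDual ℝ (StrongDual ℝ X)) : ℝ := q.2 q.1

/-- Monotonicity of a point-to-set operator `X ⇉ X*`, given by its graph. -/
def IsMonotone (T : Set (X × StrongDual ℝ X)) : Prop :=
  ∀ p ∈ T, ∀ q ∈ T, 0 ≤ (p.2 - q.2) (p.1 - q.1)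

/-- Maximal monotonicity: maximal for inclusion of graphs among the monotone operators. -/
def IsMaximalMonotone (T : Set (X × StrongDual ℝ X)) : Prop :=
  Maximal IsMonotone T

/-- Convexity of an extended-real-valued function: its epigraph is convex. -/
def IsConvex {E : Type*} [AddCommGroup E] [Module ℝ E] (f : E → EReal) : Prop :=
  Convex ℝ {p : E × ℝ | f p.1 ≤ (p.2 : EReal)}

/-- The Fenchel conjugate `f* : E* → [-∞, ∞]` of `f : E → [-∞, ∞]`. -/
def conjugate {E : Type*} [NormedAddCommGroup E] [NormedSpace ℝ E] (f : E → EReal)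
    (φ : StrongDual ℝ E) : EReal :=
  ⨆ x : E, ((φ x : EReal) - f x)

/-- The conjugate of a function on `X × X*`, as a function on `X* × X**`: the pair `(x*, x**)` is
identified with the functional `(y, y*) ↦ ⟨y, x*⟩ + ⟨y*, x**⟩` on `X × X*`. -/
def conjProd (h : X × StrongDual ℝ X → EReal)
    (q : StrongDual ℝ X × StrongDual ℝ (StrongDual ℝ X)) : EReal :=
  conjugate h (q.1.coprod q.2)

/-- Fitzpatrick's family `F_T`. -/
def family (T : Set (X × StrongDual ℝ X)) : Set (X × StrongDual ℝ X → EReal) :=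
  {h | IsConvex h ∧ LowerSemicontinuous h ∧ (∀ p, (pairing p : EReal) ≤ h p) ∧
    ∀ p ∈ T, h p = (pairing p : EReal)}

/-- The translate `h_{(x₀, x₀*)}`, where `p₀ = (x₀, x₀*)`. -/
def shifted (h : X × StrongDual ℝ X → EReal) (p₀ p : X × StrongDual ℝ X) : EReal :=
  h (p + p₀) - ((p₀.2 p.1 + p.2 p₀.1 + p₀.2 p₀.1 : ℝ) : EReal)

/-- The condition `h ≥ π` and `h* ≥ π_*`. -/
def MajorizesPairings (h : X × StrongDual ℝ X → EReal) : Prop :=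
  (∀ p, (pairing p : EReal) ≤ h p) ∧ ∀ q, (pairingStar q : EReal) ≤ conjProd h q

/-- The auxiliary condition: for every `p₀`, the infimum over `(x, x*)` of
`h_{p₀}(x, x*) + ‖x‖² / 2 + ‖x*‖² / 2` is `0`. -/
def AuxCondition (h : X × StrongDual ℝ X → EReal) : Prop :=
  ∀ p₀ : X × StrongDual ℝ X,
    (⨅ p : X × StrongDual ℝ X,
      (shifted h p₀ p + ((1 / 2 * ‖p.1‖ ^ 2 + 1 / 2 * ‖p.2‖ ^ 2 : ℝ) : EReal))) = 0

/-- Type MA. -/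
def IsTypeMA (T : Set (X × StrongDual ℝ X)) : Prop :=
  IsMaximalMonotone T ∧ ∃ h ∈ family T, MajorizesPairings h

/-- Type NI: `T` is maximal monotone and the infimum over `(y, y*) ∈ T` of
`⟨x** - y, x* - y*⟩` is at most `0` for all `(x*, x**)`. -/
def IsTypeNI (T : Set (X × StrongDual ℝ X)) : Prop :=
  IsMaximalMonotone T ∧
    ∀ (x' : StrongDual ℝ X) (x'' : StrongDual ℝ (StrongDual ℝ X)),
      (⨅ p ∈ T, (((x'' - NormedSpace.inclusionInDoubleDual ℝ X p.1) (x' - p.2) : ℝ) : EReal)) ≤ 0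

end Fitzpatrick

end

/-! Maximal monotone operators whose Fitzpatrick functions have conjugates above the duality product.

The link between the five conditions is the *quasidensity* of `T`: for every `p₀` in `X × X*` and
every `ε > 0` some `t ∈ T` satisfies
`½ ‖t.1 - p₀.1‖² + ½ ‖t.2 - p₀.2‖² + π (t - p₀) ≤ ε`. The cycle is

* **one auxiliary function gives quasidensity** (`quasidense_of_auxCondition`). The auxiliary
  condition at `p` yields a point `p'` at which `h - π` is as small as desired, and convexity at
  the midpoint bounds `‖p' - p‖` by the size of `h - π` at `p` (`exists_step`). Iterating gives a
  Cauchy sequence whose limit lies in `{h = π}`, by lower semicontinuity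
  (`exists_eq_pairing_near`), and `{h = π} = T` because `{h = π}` is monotone and contains `T`.
* **quasidensity gives type NI** (`isTypeNI_of_quasidense`). For `(x*, x**)`, quasidensity is used
  at the point `(0, x* + w)`, where `w ∈ X*` almost attains the supremum of
  `⟨w, x**⟩ - ½ ‖w‖²`, which is `½ ‖x**‖²`.
* **type NI gives `h* ≥ π_*` for every `h`** (`majorizesPairings_of_isTypeNI`), since the supremum
  defining `h*` is at least the one over `T`, where `h = π`.
* **`h* ≥ π_*` gives the auxiliary condition** (`auxCondition_of_majorizesPairings`). This is
  Fenchel duality for `h` and the continuous function `½ ‖·‖² + ½ ‖·‖²`: if the infimum were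
  positive, a hyperplane separating the epigraph of `h` from an open hypograph would provide a point
  of `X* × X**` at which `h* < π_*`.

The passage from "all `h`" to "some `h`" uses that the Fitzpatrick function of a maximal monotone
operator belongs to its family (`fitzpatrick_mem_family`). -/

noncomputable section

namespace Fitzpatrick

open Filter Topology

variable {X : Type*} [NormedAddCommGroup X] [NormedSpace ℝ X]

/-! ### The quadratic form -/

/-- The function `(x, x*) ↦ ½ ‖x‖² + ½ ‖x*‖²`. The norm of `X × X*` in Mathlib is the supremum of
the norms of the components, so this is not half the square of the product norm. -/
def halfSq (v : X × StrongDual ℝ X) : ℝ := 1 / 2 * ‖v.1‖ ^ 2 + 1 / 2 * ‖v.2‖ ^ 2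

lemma abs_apply_le {E : Type*} [NormedAddCommGroup E] [NormedSpace ℝ E] (f : StrongDual ℝ E)
    (x : E) : |f x| ≤ ‖f‖ * ‖x‖ := f.le_opNorm x

lemma neg_pairing_le_halfSq (v : X × StrongDual ℝ X) : -pairing v ≤ halfSq v := by
  have h := neg_le_of_abs_le (abs_apply_le v.2 v.1)
  unfold pairing halfSq
  nlinarith [sq_nonneg (‖v.1‖ - ‖v.2‖)]

lemma pairing_le_halfSq (v : X × StrongDual ℝ X) : pairing v ≤ halfSq v := by
  have h := le_of_abs_le (abs_apply_le v.2 v.1)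
  unfold pairing halfSq
  nlinarith [sq_nonneg (‖v.1‖ - ‖v.2‖)]

lemma sq_norm_le_two_mul_halfSq (v : X × StrongDual ℝ X) : ‖v‖ ^ 2 ≤ 2 * halfSq v := by
  unfold halfSq
  rcases max_cases ‖v.1‖ ‖v.2‖ with h | h <;> rw [Prod.norm_def, h.1] <;>
    nlinarith [sq_nonneg ‖v.1‖, sq_nonneg ‖v.2‖]

lemma continuous_halfSq : Continuous (halfSq : X × StrongDual ℝ X → ℝ) := by
  unfold halfSq
  fun_prop

lemma continuous_pairing : Continuous (pairing : X × StrongDual ℝ X → ℝ) := by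
  unfold pairing
  fun_prop

lemma halfSq_add_pairing_add_le (v w : X × StrongDual ℝ X) :
    halfSq (v + w) + pairing (v + w) ≤
      halfSq v + pairing v + 4 * ‖v‖ * ‖w‖ + 2 * ‖w‖ ^ 2 := by
  have h₁ := norm_add_le v.1 w.1
  have h₂ := norm_add_le v.2 w.2
  have v₁ := norm_fst_le v
  have v₂ := norm_snd_le v
  have w₁ := norm_fst_le w
  have w₂ := norm_snd_le w
  have q₁ : ‖v.1 + w.1‖ ^ 2 ≤ (‖v.1‖ + ‖w.1‖) ^ 2 := by gcongr
  have q₂ : ‖v.2 + w.2‖ ^ 2 ≤ (‖v.2‖ + ‖w.2‖) ^ 2 := by gcongr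
  have a₁ := le_of_abs_le (abs_apply_le v.2 w.1)
  have a₂ := le_of_abs_le (abs_apply_le w.2 v.1)
  have a₃ := le_of_abs_le (abs_apply_le w.2 w.1)
  have m₁ : ‖v.1‖ * ‖w.1‖ ≤ ‖v‖ * ‖w‖ := by gcongr
  have m₂ : ‖v.2‖ * ‖w.2‖ ≤ ‖v‖ * ‖w‖ := by gcongr
  have m₃ : ‖v.2‖ * ‖w.1‖ ≤ ‖v‖ * ‖w‖ := by gcongr
  have m₄ : ‖w.2‖ * ‖v.1‖ ≤ ‖w‖ * ‖v‖ := by gcongr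
  have m₅ : ‖w.2‖ * ‖w.1‖ ≤ ‖w‖ * ‖w‖ := by gcongr
  have m₆ : ‖w.1‖ ^ 2 ≤ ‖w‖ ^ 2 := by gcongr
  have m₇ : ‖w.2‖ ^ 2 ≤ ‖w‖ ^ 2 := by gcongr
  simp only [halfSq, pairing, Prod.fst_add, Prod.snd_add, add_apply, map_add]
  nlinarith

/-- The inequality `½ ‖φ‖² ≤ sup_w (φ w - ½ ‖w‖²)`, with a near-maximizer as witness. -/
lemma exists_near_max {E : Type*} [NormedAddCommGroup E] [NormedSpace ℝ E] (φ : StrongDual ℝ E)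
    {ε : ℝ} (hε : 0 < ε) : ∃ w : E, 1 / 2 * ‖w‖ ^ 2 + 1 / 2 * ‖φ‖ ^ 2 - ε ≤ φ w := by
  rcases eq_or_lt_of_le (norm_nonneg φ) with h0 | h0
  · exact ⟨0, by simp [← h0]; exact hε.le⟩
  have hr : ‖φ‖ - ε / ‖φ‖ < ‖φ‖ := by linarith [div_pos hε h0]
  obtain ⟨x, hx, hφ⟩ := ContinuousLinearMap.exists_lt_apply_of_lt_opNorm φ hr
  obtain ⟨y, hy, hφy⟩ : ∃ y : E, ‖y‖ ≤ 1 ∧ ‖φ‖ - ε / ‖φ‖ < φ y := by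
    rw [Real.norm_eq_abs] at hφ
    rcases abs_cases (φ x) with h | h
    · exact ⟨x, hx.le, by linarith⟩
    · exact ⟨-x, by simpa using hx.le, by rw [map_neg]; linarith⟩
  refine ⟨‖φ‖ • y, ?_⟩
  have h₁ : ‖‖φ‖ • y‖ ≤ ‖φ‖ := by
    rw [norm_smul, norm_norm]
    exact mul_le_of_le_one_right h0.le hy
  have h₂ : ‖‖φ‖ • y‖ ^ 2 ≤ ‖φ‖ ^ 2 := by gcongr
  have h₃ : ‖φ‖ * (‖φ‖ - ε / ‖φ‖) = ‖φ‖ ^ 2 - ε := by field_simp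
  rw [map_smul, smul_eq_mul]
  nlinarith [mul_lt_mul_of_pos_left hφy h0]

/-! ### Convex functions above the duality product -/

lemma midpoint_le {h : X × StrongDual ℝ X → EReal} (hc : IsConvex h)
    (hπ : ∀ p, (pairing p : EReal) ≤ h p) {p q : X × StrongDual ℝ X} {a b : ℝ}
    (ha : h p ≤ (a : EReal)) (hb : h q ≤ (b : EReal)) :
    1 / 2 * pairing p + 1 / 2 * pairing q - 1 / 4 * pairing (q - p) ≤ 1 / 2 * a + 1 / 2 * b := by
  have key := @hc (p, a) ha (q, b) hb (1 / 2) (1 / 2) (by norm_num) (by norm_num) (by norm_num)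
  have := (hπ _).trans key
  rw [EReal.coe_le_coe_iff] at this
  simp only [pairing, Prod.fst_add, Prod.snd_add, Prod.smul_fst, Prod.smul_snd, Prod.fst_sub,
    Prod.snd_sub, smul_eq_mul, map_add, map_sub, map_smul, add_apply,
    sub_apply, smul_apply] at this ⊢
  linarith

lemma isMonotone_eq_pairing {h : X × StrongDual ℝ X → EReal} (hc : IsConvex h)
    (hπ : ∀ p, (pairing p : EReal) ≤ h p) :
    IsMonotone {p | h p = (pairing p : EReal)} := by
  intro p hp q hq
  have := midpoint_le hc hπ (le_of_eq hq) (le_of_eq hp)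
  change 0 ≤ pairing (p - q)
  linarith

lemma IsMaximalMonotone.mem_of_eq_pairing {T : Set (X × StrongDual ℝ X)}
    (hT : IsMaximalMonotone T) {h : X × StrongDual ℝ X → EReal} (hh : h ∈ family T)
    {p : X × StrongDual ℝ X} (hp : h p = (pairing p : EReal)) : p ∈ T :=
  hT.2 (isMonotone_eq_pairing hh.1 hh.2.2.1) hh.2.2.2 hp

lemma shift_term_eq (p₀ v : X × StrongDual ℝ X) :
    p₀.2 v.1 + v.2 p₀.1 + p₀.2 p₀.1 = pairing (v + p₀) - pairing v := by
  simp [pairing]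
  ring

lemma shifted_add_eq {h : X × StrongDual ℝ X → EReal} {p₀ v : X × StrongDual ℝ X} {a : ℝ}
    (ha : h (v + p₀) = (a : EReal)) :
    shifted h p₀ v + ((1 / 2 * ‖v.1‖ ^ 2 + 1 / 2 * ‖v.2‖ ^ 2 : ℝ) : EReal) =
      ((a - pairing (v + p₀) + (halfSq v + pairing v) : ℝ) : EReal) := by
  rw [shifted, ha, shift_term_eq, ← EReal.coe_sub, ← EReal.coe_add]
  unfold halfSq
  congr 1
  ring

lemma shifted_add_eq_top {h : X × StrongDual ℝ X → EReal} {p₀ v : X × StrongDual ℝ X}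
    (ha : h (v + p₀) = ⊤) :
    shifted h p₀ v + ((1 / 2 * ‖v.1‖ ^ 2 + 1 / 2 * ‖v.2‖ ^ 2 : ℝ) : EReal) = ⊤ := by
  rw [shifted, ha, EReal.top_sub_coe, EReal.top_add_coe]

lemma eq_top_or_exists_coe {h : X × StrongDual ℝ X → EReal}
    (hπ : ∀ p, (pairing p : EReal) ≤ h p) (p : X × StrongDual ℝ X) :
    h p = ⊤ ∨ ∃ a : ℝ, h p = (a : EReal) ∧ pairing p ≤ a := by
  have := hπ p
  induction hp : h p with
  | bot => rw [hp] at this; simp at this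
  | top => exact Or.inl rfl
  | coe a => exact Or.inr ⟨a, rfl, by rw [hp] at this; exact_mod_cast this⟩

/-! ### From the auxiliary condition to quasidensity -/

/-- One step of the iteration. The point `t` is a reference point where `h` is finite; it equals
`p` in all steps but the first, since the starting point need not lie in the domain of `h`. -/
lemma exists_step {h : X × StrongDual ℝ X → EReal} (hc : IsConvex h)
    (hπ : ∀ p, (pairing p : EReal) ≤ h p) (haux : AuxCondition h)
    {t p : X × StrongDual ℝ X} {ε δ : ℝ} (ht : h t ≤ ((pairing t + ε : ℝ) : EReal))
    (hδ : 0 < δ) :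
    ∃ p', h p' ≤ ((pairing p' + δ : ℝ) : EReal) ∧
      halfSq (p' - p) + pairing (p' - p) ≤ δ ∧
      halfSq (p' - p) ≤ 4 * (δ + ε) + 6 * halfSq (t - p) := by
  have hlt : (⨅ v : X × StrongDual ℝ X, (shifted h p v +
      ((1 / 2 * ‖v.1‖ ^ 2 + 1 / 2 * ‖v.2‖ ^ 2 : ℝ) : EReal))) < (δ : EReal) := by
    rw [haux p]
    exact_mod_cast hδ
  obtain ⟨v, hv⟩ := iInf_lt_iff.1 hlt
  rcases eq_top_or_exists_coe hπ (v + p) with htop | ⟨a, ha, hπa⟩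
  · rw [shifted_add_eq_top htop] at hv
    exact absurd hv (not_lt.2 le_top)
  rw [shifted_add_eq ha, EReal.coe_lt_coe_iff] at hv
  have hr := neg_pairing_le_halfSq v
  have hmid := midpoint_le hc hπ ht ha.le
  -- The midpoint of `t` and `v + p` is compared with `π`, so the difference `v - u` appears.
  set u := t - p with hu
  have hdiff : v + p - t = v - u := by rw [hu]; abel
  rw [hdiff] at hmid
  have hcross : pairing (v - u) = pairing v + pairing u - (v.2 u.1 + u.2 v.1) := by
    simp [pairing]
    ring
  have c₁ := neg_le_of_abs_le (abs_apply_le v.2 u.1)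
  have c₂ := neg_le_of_abs_le (abs_apply_le u.2 v.1)
  have hu' := pairing_le_halfSq u
  refine ⟨v + p, ?_, ?_, ?_⟩
  · rw [ha, EReal.coe_le_coe_iff]
    linarith
  · rw [add_sub_cancel_right]
    linarith
  · rw [add_sub_cancel_right]
    have e : 1 / 4 * (v.2 u.1 + u.2 v.1) ≥ -(1 / 8 * halfSq v + 1 / 2 * halfSq u) := by
      unfold halfSq
      nlinarith [sq_nonneg (‖v.2‖ - 2 * ‖u.1‖), sq_nonneg (‖v.1‖ - 2 * ‖u.2‖)]
    linarith

/-- Near a point where `h - π` is small there is a point where `h = π`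
(a Brøndsted–Rockafellar property). -/
lemma exists_eq_pairing_near [CompleteSpace X] {h : X × StrongDual ℝ X → EReal}
    (hc : IsConvex h) (hlsc : LowerSemicontinuous h) (hπ : ∀ p, (pairing p : EReal) ≤ h p)
    (haux : AuxCondition h) {p : X × StrongDual ℝ X} {η : ℝ} (hη : 0 < η)
    (hp : h p ≤ ((pairing p + η ^ 2 : ℝ) : EReal)) :
    ∃ z, h z = (pairing z : EReal) ∧ ‖z - p‖ ≤ 8 * η := by
  have step (n : ℕ) (q : {q // h q ≤ ((pairing q + (η / 2 ^ n) ^ 2 : ℝ) : EReal)}) :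
      ∃ q' : {q // h q ≤ ((pairing q + (η / 2 ^ (n + 1)) ^ 2 : ℝ) : EReal)},
        dist q.1 q'.1 ≤ 4 * η / 2 ^ n := by
    have hpos : 0 < η / 2 ^ (n + 1) := by positivity
    obtain ⟨q', h₁, -, h₃⟩ := exists_step (p := q.1) hc hπ haux q.2 (pow_pos hpos 2)
    refine ⟨⟨q', h₁⟩, ?_⟩
    rw [dist_comm, dist_eq_norm]
    have h0 : halfSq (q.1 - q.1) = 0 := by simp [halfSq]
    rw [h0] at h₃
    have hn := sq_norm_le_two_mul_halfSq (q' - q.1)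
    have e : η / 2 ^ (n + 1) = η / 2 ^ n / 2 := by rw [pow_succ]; field_simp
    rw [e] at h₃
    have e' : 4 * η / 2 ^ n = 4 * (η / 2 ^ n) := by ring
    rw [e']
    refine abs_le_of_sq_le_sq' ?_ (by positivity) |>.2
    nlinarith [sq_nonneg (η / 2 ^ n)]
  choose next hnext using step
  let s : (n : ℕ) → {q // h q ≤ ((pairing q + (η / 2 ^ n) ^ 2 : ℝ) : EReal)} :=
    fun n => Nat.rec ⟨p, by simpa using hp⟩ next n
  have hs (n : ℕ) : dist (s n).1 (s (n + 1)).1 ≤ 8 * η / 2 / 2 ^ n := by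
    have := hnext n (s n)
    have e : 8 * η / 2 = 4 * η := by ring
    rw [e]
    exact this
  obtain ⟨z, hz⟩ := cauchySeq_tendsto_of_complete (cauchySeq_of_le_geometric_two hs)
  refine ⟨z, le_antisymm ?_ (hπ z), ?_⟩
  · by_contra hlt
    rw [not_le] at hlt
    obtain ⟨c, hc₁, hc₂⟩ := EReal.lt_iff_exists_real_btwn.1 hlt
    rw [EReal.coe_lt_coe_iff] at hc₁
    have ev₁ : ∀ᶠ n in atTop, (c : EReal) < h (s n).1 := hz.eventually (hlsc z c hc₂)
    have hlim : Tendsto (fun n => pairing (s n).1 + (η / 2 ^ n) ^ 2) atTop (𝓝 (pairing z)) := by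
      have h₁ : Tendsto (fun n => pairing (s n).1) atTop (𝓝 (pairing z)) :=
        (continuous_pairing.tendsto z).comp hz
      have h₂ : Tendsto (fun n : ℕ => (η / 2 ^ n) ^ 2) atTop (𝓝 0) := by
        have : Tendsto (fun n : ℕ => η / (2 : ℝ) ^ n) atTop (𝓝 0) :=
          tendsto_const_nhds.div_atTop (tendsto_pow_atTop_atTop_of_one_lt one_lt_two)
        simpa using this.pow 2
      simpa using h₁.add h₂
    have ev₂ := hlim.eventually (gt_mem_nhds hc₁)
    obtain ⟨n, h₁, h₂⟩ := (ev₁.and ev₂).exists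
    have := h₁.trans_le (s n).2
    rw [EReal.coe_lt_coe_iff] at this
    linarith
  · have := dist_le_of_le_geometric_two_of_tendsto₀ hs hz
    rwa [dist_comm, dist_eq_norm] at this

/-- Quasidensity of a subset of `X × X*` with respect to the quadratic form
`½ ‖x‖² + ½ ‖x*‖² + ⟨x, x*⟩`. -/
def Quasidense (T : Set (X × StrongDual ℝ X)) : Prop :=
  ∀ p : X × StrongDual ℝ X, ∀ ε > 0, ∃ t ∈ T, halfSq (t - p) + pairing (t - p) ≤ ε

lemma IsMaximalMonotone.nonempty {T : Set (X × StrongDual ℝ X)} (hT : IsMaximalMonotone T) :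
    T.Nonempty := by
  by_contra hne
  rw [Set.not_nonempty_iff_eq_empty] at hne
  have hmono : IsMonotone ({0} : Set (X × StrongDual ℝ X)) := by
    rintro p rfl q rfl
    simp
  have : (0 : X × StrongDual ℝ X) ∈ T := hT.2 hmono (by simp [hne]) rfl
  simp [hne] at this

lemma quasidense_of_auxCondition [CompleteSpace X] {T : Set (X × StrongDual ℝ X)}
    (hT : IsMaximalMonotone T) {h : X × StrongDual ℝ X → EReal} (hh : h ∈ family T)
    (haux : AuxCondition h) : Quasidense T := by
  intro p ε hε
  obtain ⟨hc, hlsc, hπ, hTπ⟩ := id hh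
  obtain ⟨t, ht⟩ := hT.nonempty
  -- `B` bounds the first step uniformly in `η ≤ 1`, so that a displacement of order `η` changes
  -- the quadratic form by at most a constant times `η`.
  set B : ℝ := 9 + 12 * halfSq (t - p) with hB
  have hg : 0 ≤ halfSq (t - p) := by unfold halfSq; positivity
  have hBpos : 0 < B := by positivity
  set K : ℝ := 129 + 32 * B with hK
  have hKpos : 0 < K := by positivity
  obtain ⟨η, hη, hη1, hηK⟩ : ∃ η : ℝ, 0 < η ∧ η ≤ 1 ∧ η * K ≤ ε :=
    ⟨min 1 (ε / K), lt_min one_pos (div_pos hε hKpos), min_le_left _ _,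
      (le_div_iff₀ hKpos).1 (min_le_right _ _)⟩
  have ht' : h t ≤ ((pairing t + 0 : ℝ) : EReal) := by rw [hTπ t ht, add_zero]
  obtain ⟨q, hq₁, hq₂, hq₃⟩ := exists_step (p := p) hc hπ haux ht' (pow_pos hη 2)
  obtain ⟨z, hz, hzq⟩ := exists_eq_pairing_near hc hlsc hπ haux hη hq₁
  refine ⟨z, hT.mem_of_eq_pairing hh hz, ?_⟩
  have hη2 : η ^ 2 ≤ η := by nlinarith
  have hqB : ‖q - p‖ ≤ B := by
    have := sq_norm_le_two_mul_halfSq (q - p)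
    nlinarith [sq_nonneg (‖q - p‖ - 1)]
  have hsplit : z - p = (q - p) + (z - q) := by abel
  rw [hsplit]
  have hadd := halfSq_add_pairing_add_le (q - p) (z - q)
  have m₁ : ‖q - p‖ * ‖z - q‖ ≤ B * (8 * η) := by gcongr
  have m₂ : ‖z - q‖ ^ 2 ≤ (8 * η) ^ 2 := by gcongr
  nlinarith

/-! ### From quasidensity to type NI -/

lemma isTypeNI_of_quasidense {T : Set (X × StrongDual ℝ X)} (hT : IsMaximalMonotone T)
    (hq : Quasidense T) : IsTypeNI T := by
  refine ⟨hT, fun x' x'' => ?_⟩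
  by_contra hlt
  rw [not_le] at hlt
  obtain ⟨ε, hε, hε'⟩ := EReal.lt_iff_exists_real_btwn.1 hlt
  have hε0 : 0 < ε := by exact_mod_cast hε
  obtain ⟨w, hw⟩ := exists_near_max x'' (ε := ε / 4) (by positivity)
  obtain ⟨⟨y, y'⟩, ht, hr⟩ := hq (0, x' + w) (ε / 4) (by positivity)
  have hlow := hε'.trans_le (iInf₂_le (y, y') ht)
  rw [EReal.coe_lt_coe_iff] at hlow
  obtain ⟨s, rfl⟩ : ∃ s, y' = x' + w + s := ⟨y' - (x' + w), by abel⟩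
  have e : x' - (x' + w + s) = -(w + s) := by abel
  simp only [halfSq, pairing, Prod.mk_sub_mk, sub_zero, add_sub_cancel_left] at hr
  simp only [e, sub_apply, NormedSpace.dual_def, map_neg, map_add] at hlow
  have a₁ := neg_le_of_abs_le (abs_apply_le x'' s)
  have a₂ := le_of_abs_le (abs_apply_le w y)
  nlinarith [sq_nonneg (‖x''‖ - ‖s‖), sq_nonneg (‖w‖ - ‖y‖)]

/-! ### From type NI to conjugates above the duality product -/

lemma majorizesPairings_of_isTypeNI {T : Set (X × StrongDual ℝ X)} (hT : IsTypeNI T)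
    {h : X × StrongDual ℝ X → EReal} (hh : h ∈ family T) : MajorizesPairings h := by
  refine ⟨hh.2.2.1, fun ⟨x', x''⟩ => ?_⟩
  refine le_of_forall_lt fun c hc => ?_
  obtain ⟨r, hcr, hr⟩ := EReal.lt_iff_exists_real_btwn.1 hc
  rw [EReal.coe_lt_coe_iff] at hr
  have hpos : (0 : EReal) < ((pairingStar (x', x'') - r : ℝ) : EReal) := by
    exact_mod_cast sub_pos.2 hr
  obtain ⟨⟨y, y'⟩, ht⟩ := iInf_lt_iff.1 ((hT.2 x' x'').trans_lt hpos)
  obtain ⟨ht, hlt⟩ := iInf_lt_iff.1 ht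
  rw [EReal.coe_lt_coe_iff] at hlt
  refine hcr.trans (lt_of_lt_of_le ?_ (le_iSup _ (y, y')))
  rw [hh.2.2.2 _ ht, ← EReal.coe_sub, EReal.coe_lt_coe_iff]
  simp only [pairing, pairingStar, sub_apply, NormedSpace.dual_def, map_sub,
    ContinuousLinearMap.coprod_apply] at hlt ⊢
  linarith

/-! ### From conjugates above the duality product to the auxiliary condition -/

lemma convexOn_halfSq : ConvexOn ℝ Set.univ (halfSq : X × StrongDual ℝ X → ℝ) := by
  have h₁ : ConvexOn ℝ Set.univ (fun v : X × StrongDual ℝ X => ‖v.1‖ ^ 2) :=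
    ((convexOn_univ_norm (E := X)).comp_linearMap (LinearMap.fst ℝ X (StrongDual ℝ X))).pow
      (fun _ _ => norm_nonneg _) 2
  have h₂ : ConvexOn ℝ Set.univ (fun v : X × StrongDual ℝ X => ‖v.2‖ ^ 2) :=
    ((convexOn_univ_norm (E := StrongDual ℝ X)).comp_linearMap
      (LinearMap.snd ℝ X (StrongDual ℝ X))).pow (fun _ _ => norm_nonneg _) 2
  exact (h₁.smul (by norm_num : (0 : ℝ) ≤ 1 / 2)).add (h₂.smul (by norm_num : (0 : ℝ) ≤ 1 / 2))

/-- The sandwich theorem: a convex function that is finite somewhere and lies above a continuous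
concave function `-k` is separated from it by a continuous affine function. -/
lemma exists_affine_between {E : Type*} [NormedAddCommGroup E] [NormedSpace ℝ E] {f : E → EReal}
    (hf : IsConvex f) {k : E → ℝ} (hk : ConvexOn ℝ Set.univ k) (hkc : Continuous k)
    (hfk : ∀ x, ((-k x : ℝ) : EReal) ≤ f x) {x₀ : E} {a₀ : ℝ} (hx₀ : f x₀ ≤ (a₀ : EReal)) :
    ∃ (ψ : StrongDual ℝ E) (c : ℝ), (∀ x, -k x ≤ ψ x + c) ∧
      ∀ x, ((ψ x + c : ℝ) : EReal) ≤ f x := by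
  have hopen : IsOpen {p : E × ℝ | p.2 < -k p.1} :=
    isOpen_lt continuous_snd (by fun_prop)
  have hconv : Convex ℝ {p : E × ℝ | p.2 < -k p.1} := by
    simpa using hk.neg.convex_strict_hypograph
  have hdisj : Disjoint {p : E × ℝ | p.2 < -k p.1} {p : E × ℝ | f p.1 ≤ (p.2 : EReal)} := by
    rw [Set.disjoint_left]
    intro p hp hp'
    have h := (hfk p.1).trans hp'
    rw [EReal.coe_le_coe_iff] at h
    exact absurd h (not_le.2 hp)
  obtain ⟨φ, u, hlt, hle⟩ := geometric_hahn_banach_open hconv hopen hf hdisj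
  set c := φ (0, 1) with hc
  have hφ (x : E) (r : ℝ) : φ (x, r) = φ (x, 0) + r * c := by
    have : (x, r) = (x, (0 : ℝ)) + r • ((0 : E), (1 : ℝ)) := by simp
    rw [this, map_add, map_smul, smul_eq_mul]
  -- The hyperplane is not vertical, because `k` is finite at the point `x₀` of the domain of `f`.
  have hcpos : 0 < c := by
    have h₁ := hle (x₀, a₀) hx₀
    have h₂ := hlt (x₀, min (-k x₀) a₀ - 1) (by
      change min (-k x₀) a₀ - 1 < -k x₀
      linarith [min_le_left (-k x₀) a₀])
    rw [hφ] at h₁ h₂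
    have := min_le_right (-k x₀) a₀
    by_contra hneg
    nlinarith
  refine ⟨-(c⁻¹ • φ.comp (ContinuousLinearMap.inl ℝ E ℝ)), u / c, fun x => ?_, fun x => ?_⟩
  · refine le_of_forall_lt fun r hr => ?_
    have h := hlt (x, r) hr
    rw [hφ] at h
    have : r < (u - φ (x, 0)) / c := by rw [lt_div_iff₀ hcpos]; linarith
    calc r < (u - φ (x, 0)) / c := this
      _ = _ := by simp; ring
  · refine EReal.le_of_forall_lt_iff_le.1 fun r hr => ?_
    have h := hle (x, r) hr.le
    rw [hφ] at h
    have : (u - φ (x, 0)) / c ≤ r := by rw [div_le_iff₀ hcpos]; linarith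
    rw [EReal.coe_le_coe_iff]
    calc _ = (u - φ (x, 0)) / c := by simp; ring
      _ ≤ r := this

lemma auxCondition_of_majorizesPairings {h : X × StrongDual ℝ X → EReal} (hc : IsConvex h)
    (hfin : ∃ p, h p ≠ ⊤) (hm : MajorizesPairings h) : AuxCondition h := by
  obtain ⟨hπ, hstar⟩ := hm
  intro p₀
  refine le_antisymm ?_ (le_iInf fun v => ?_)
  swap
  · rcases eq_top_or_exists_coe hπ (v + p₀) with htop | ⟨a, ha, hπa⟩
    · rw [shifted_add_eq_top htop]
      exact le_top
    · rw [shifted_add_eq ha]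
      have := neg_pairing_le_halfSq v
      exact_mod_cast (by linarith : (0 : ℝ) ≤ a - pairing (v + p₀) + (halfSq v + pairing v))
  by_contra hlt
  rw [not_le] at hlt
  obtain ⟨μ, hμ, hμ'⟩ := EReal.lt_iff_exists_real_btwn.1 hlt
  have hμ0 : 0 < μ := by exact_mod_cast hμ
  -- `pairing p - pairing (p - p₀)` is the affine function subtracted in the shift of `h`.
  have hk : ConvexOn ℝ Set.univ (fun p : X × StrongDual ℝ X =>
      halfSq (p - p₀) - (pairing p - pairing (p - p₀)) - μ) := by
    have h₁ : ConvexOn ℝ Set.univ (fun p : X × StrongDual ℝ X => halfSq (p - p₀)) := by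
      simpa [sub_eq_add_neg, Function.comp_def] using convexOn_halfSq.translate_left (-p₀)
    have h₂ : ConcaveOn ℝ Set.univ
        (fun p : X × StrongDual ℝ X => pairing p - pairing (p - p₀)) := by
      refine ⟨convex_univ, fun p _ q _ a b _ _ hab => le_of_eq ?_⟩
      obtain rfl : b = 1 - a := by linarith
      simp [pairing]
      ring
    exact (h₁.sub h₂).sub (concaveOn_const μ convex_univ)
  have hkc : Continuous (fun p : X × StrongDual ℝ X =>
      halfSq (p - p₀) - (pairing p - pairing (p - p₀)) - μ) := by
    have := continuous_halfSq (X := X)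
    have := continuous_pairing (X := X)
    fun_prop
  obtain ⟨p₁, hp₁⟩ := hfin
  obtain ⟨a₁, ha₁, -⟩ := (eq_top_or_exists_coe hπ p₁).resolve_left hp₁
  obtain ⟨ψ, c, hψk, hψh⟩ := exists_affine_between hc hk hkc (fun p => by
    rcases eq_top_or_exists_coe hπ p with htop | ⟨a, ha, -⟩
    · rw [htop]
      exact le_top
    · have h₁ := hμ'.trans_le (iInf_le _ (p - p₀))
      rw [shifted_add_eq (by rw [sub_add_cancel]; exact ha), EReal.coe_lt_coe_iff,
        sub_add_cancel] at h₁
      rw [ha, EReal.coe_le_coe_iff]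
      linarith) ha₁.le
  set x' := ψ.comp (ContinuousLinearMap.inl ℝ X (StrongDual ℝ X)) with hx'
  set x'' := ψ.comp (ContinuousLinearMap.inr ℝ X (StrongDual ℝ X)) with hx''
  have hψ : x'.coprod x'' = ψ := by
    ext p <;> simp [hx', hx'']
  have hψ_apply (p : X × StrongDual ℝ X) : ψ p = x' p.1 + x'' p.2 := by
    rw [← hψ, ContinuousLinearMap.coprod_apply]
  have hconj : conjProd h (x', x'') ≤ ((-c : ℝ) : EReal) := by
    refine iSup_le fun p => ?_
    simp only [hψ]
    rcases eq_top_or_exists_coe hπ p with htop | ⟨a, ha, -⟩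
    · rw [htop, EReal.sub_top]
      exact bot_le
    · have h₁ := hψh p
      rw [ha, EReal.coe_le_coe_iff] at h₁
      rw [ha, ← EReal.coe_sub, EReal.coe_le_coe_iff]
      linarith
  have hπc := (hstar (x', x'')).trans hconj
  rw [EReal.coe_le_coe_iff] at hπc
  -- After translating by `p₀`, the affine function is evaluated at a near-minimizer of its sum
  -- with `halfSq`.
  set α : StrongDual ℝ X := x' - p₀.2 with hα
  set β : StrongDual ℝ (StrongDual ℝ X) :=
    x'' - NormedSpace.inclusionInDoubleDual ℝ X p₀.1 with hβ
  obtain ⟨v₁, hv₁⟩ := exists_near_max α (ε := μ / 4) (by positivity)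
  obtain ⟨v₂, hv₂⟩ := exists_near_max β (ε := μ / 4) (by positivity)
  have hfin := hψk (p₀ - (v₁, v₂))
  have hβα := neg_le_of_abs_le (abs_apply_le β α)
  rw [hψ_apply] at hfin
  have ev : p₀ - (v₁, v₂) - p₀ = -(v₁, v₂) := by abel
  rw [ev] at hfin
  simp only [hα, hβ, sub_apply, NormedSpace.dual_def, map_sub] at hv₁ hv₂ hβα
  simp only [halfSq, pairing, pairingStar, Prod.fst_neg, Prod.snd_neg, Prod.fst_sub, Prod.snd_sub,
    norm_neg, sub_apply, neg_apply, map_neg, map_sub]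
    at hfin hπc
  nlinarith [sq_nonneg (‖x' - p₀.2‖ - ‖x'' - NormedSpace.inclusionInDoubleDual ℝ X p₀.1‖)]

/-! ### The Fitzpatrick function -/

/-- The Fitzpatrick function `(x, x*) ↦ sup_{(y, y*) ∈ T} ⟨x, y*⟩ + ⟨y, x*⟩ - ⟨y, y*⟩`. -/
def fitzpatrick (T : Set (X × StrongDual ℝ X)) (p : X × StrongDual ℝ X) : EReal :=
  ⨆ t ∈ T, ((t.2 p.1 + p.2 t.1 - pairing t : ℝ) : EReal)

lemma fitzpatrick_term (p t : X × StrongDual ℝ X) :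
    t.2 p.1 + p.2 t.1 - pairing t = pairing p - pairing (p - t) := by
  simp [pairing]
  ring

lemma IsMaximalMonotone.exists_pairing_sub_nonpos {T : Set (X × StrongDual ℝ X)}
    (hT : IsMaximalMonotone T) (p : X × StrongDual ℝ X) : ∃ t ∈ T, pairing (p - t) ≤ 0 := by
  by_contra! hpos
  have hmono : IsMonotone (insert p T) := by
    rintro q (rfl | hq) r (rfl | hr)
    · simp
    · exact (hpos r hr).le
    · have := (hpos q hq).le
      have e : pairing (r - q) = (q.2 - r.2) (q.1 - r.1) := by simp [pairing]; ring
      rwa [e] at this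
    · exact hT.1 q hq r hr
  have hp : p ∈ T := hT.2 hmono (Set.subset_insert p T) (Set.mem_insert p T)
  have := hpos p hp
  simp [pairing] at this

lemma fitzpatrick_mem_family {T : Set (X × StrongDual ℝ X)} (hT : IsMaximalMonotone T) :
    fitzpatrick T ∈ family T := by
  have hge (p : X × StrongDual ℝ X) : (pairing p : EReal) ≤ fitzpatrick T p := by
    obtain ⟨t, ht, hle⟩ := hT.exists_pairing_sub_nonpos p
    refine le_trans ?_ (le_iSup₂ (f := fun (t : X × StrongDual ℝ X) (_ : t ∈ T) =>
      ((t.2 p.1 + p.2 t.1 - pairing t : ℝ) : EReal)) t ht)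
    rw [fitzpatrick_term, EReal.coe_le_coe_iff]
    linarith
  refine ⟨?_, ?_, hge, fun p hp => le_antisymm ?_ (hge p)⟩
  · have e : {p : (X × StrongDual ℝ X) × ℝ | fitzpatrick T p.1 ≤ (p.2 : EReal)} =
        ⋂ t ∈ T, {p | t.2 p.1.1 + p.1.2 t.1 - pairing t ≤ p.2} := by
      ext p
      simp only [fitzpatrick, iSup_le_iff, EReal.coe_le_coe_iff, Set.mem_ofPred_eq, Set.mem_iInter]
    rw [IsConvex, e]
    refine convex_iInter₂ fun t _ => fun p hp q hq a b ha hb hab => ?_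
    obtain rfl : b = 1 - a := by linarith
    simp only [Set.mem_ofPred_eq] at hp hq
    simp only [Set.mem_ofPred_eq, Prod.fst_add, Prod.snd_add, Prod.smul_fst, Prod.smul_snd, map_add,
      map_smul, add_apply, smul_apply, smul_eq_mul]
    nlinarith [mul_le_mul_of_nonneg_left hp ha, mul_le_mul_of_nonneg_left hq hb]
  · refine lowerSemicontinuous_biSup fun t _ => Continuous.lowerSemicontinuous ?_
    exact continuous_coe_real_ereal.comp (by fun_prop)
  · refine iSup₂_le fun t ht => ?_
    rw [fitzpatrick_term, EReal.coe_le_coe_iff]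
    have : 0 ≤ pairing (p - t) := hT.1 p hp t ht
    linarith

lemma IsMaximalMonotone.auxCondition_of_majorizesPairings {T : Set (X × StrongDual ℝ X)}
    (hT : IsMaximalMonotone T) {h : X × StrongDual ℝ X → EReal} (hh : h ∈ family T)
    (hm : MajorizesPairings h) : AuxCondition h := by
  obtain ⟨t, ht⟩ := hT.nonempty
  exact Fitzpatrick.auxCondition_of_majorizesPairings hh.1
    ⟨t, by rw [hh.2.2.2 t ht]; exact EReal.coe_ne_top _⟩ hm

end Fitzpatrick

end

theorem theorem2 {X : Type*} [NormedAddCommGroup X] [NormedSpace ℝ X] [CompleteSpace X]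
    (T : Set (X × StrongDual ℝ X)) :
    List.TFAE
      [Fitzpatrick.IsTypeMA T,
       Fitzpatrick.IsMaximalMonotone T ∧
         ∀ h ∈ Fitzpatrick.family T, Fitzpatrick.MajorizesPairings h,
       Fitzpatrick.IsMaximalMonotone T ∧
         ∃ h ∈ Fitzpatrick.family T, Fitzpatrick.AuxCondition h,
       Fitzpatrick.IsMaximalMonotone T ∧
         ∀ h ∈ Fitzpatrick.family T, Fitzpatrick.AuxCondition h,
       Fitzpatrick.IsTypeNI T] := by
  tfae_have 1 → 3 := fun ⟨hT, h, hh, hm⟩ =>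
    ⟨hT, h, hh, hT.auxCondition_of_majorizesPairings hh hm⟩
  tfae_have 3 → 5 := fun ⟨hT, _, hh, haux⟩ =>
    Fitzpatrick.isTypeNI_of_quasidense hT (Fitzpatrick.quasidense_of_auxCondition hT hh haux)
  tfae_have 5 → 2 := fun hT =>
    ⟨hT.1, fun _ hh => Fitzpatrick.majorizesPairings_of_isTypeNI hT hh⟩
  tfae_have 2 → 1 := fun ⟨hT, hall⟩ =>
    ⟨hT, _, Fitzpatrick.fitzpatrick_mem_family hT, hall _ (Fitzpatrick.fitzpatrick_mem_family hT)⟩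
  tfae_have 2 → 4 := fun ⟨hT, hall⟩ =>
    ⟨hT, fun h hh => hT.auxCondition_of_majorizesPairings hh (hall h hh)⟩
  tfae_have 4 → 3 := fun ⟨hT, hall⟩ =>
    ⟨hT, _, Fitzpatrick.fitzpatrick_mem_family hT, hall _ (Fitzpatrick.fitzpatrick_mem_family hT)⟩
  tfae_finish
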